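/- Let $m\ge 1$ and $n\ge 0$ be integers, $A\in\mathbb C^{m\times n}$ and $D\in\mathbb C^{n\times m}$, and let $\star\in\{\top,*\}$ denote either the transpose or the conjugate transpose. Consider the matrix pencil $\mathcal P(\lambda)=A-\lambda D^\star$. It is called regular if it is square ($m=n$) and $q(\lambda)=\det\mathcal P(\lambda)$ is not identically zero; in that case its spectrum $\Lambda(\mathcal P)\subseteq\mathbb C\cup\{\infty\}$ is the set of roots of $q$, together with $\infty$ if $\deg q<n$, and $m_1(\mathcal P)$ is the multiplicity of $1$ as a root of $q$ (equal to $0$ if $q(1)\ne0$). With the conventions $0^{-1}=\infty$, $\infty^{-1}=0$, $\overline\infty=\infty$, a set $\mathcal S\subseteq\mathbb C\cup\{\infty\}$ is called reciprocal free if $\lambda\ne\mu^{-1}$ for all $\lambda,\mu\in\mathcal S$, and $*$-reciprocal free if $\lambda\neq(\overline\mu)^{-1}$ for all $\lambda,\mu\in\mathcal S$ (in both cases $\lambda=\mu$ is allowed). Then the equation $AX+X^\star D=E$ has exactly one solution $X\in\mathbb C^{n\times m}$ for every right-hand side $E\in\mathbb C^{m\times m}$ if and only if $\mathcal P(\lambda)$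 is regular and the following condition holds: - if $\star=\top$: $\Lambda(\mathcal P)\setminus\{1\}$ is reciprocal free and $m_1(\mathcal P)\le 1$; - if $\star=*$: $\Lambda(\mathcal P)$ is $*$-reciprocal free. -/

import Mathlib

open Matrix Polynomial

/-- A (possibly rectangular) complex matrix pencil `P(t) = t * lead + const`. -/
structure MatrixPencil (m n : ℕ) where
  lead : Matrix (Fin m) (Fin n) ℂ
  const : Matrix (Fin m) (Fin n) ℂ

namespace MatrixPencil

noncomputable section

variable {m n : ℕ}

/-- The pencil as a matrix whose entries are polynomials in the parameter. -/
def toMatrix (P : MatrixPencil m n) : Matrix (Fin m) (Fin n) ℂ[X] :=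
  (X : ℂ[X]) • P.lead.map C + P.const.map C

/-- The polynomial `q(t) = det P(t)` of a square pencil. A rectangular pencil has no determinant;
the value `0` is used for it, and such a pencil is never regular. -/
def detPoly (P : MatrixPencil m n) : ℂ[X] :=
  if h : m = n then (P.toMatrix.submatrix id (Fin.cast h)).det else 0

/-- A pencil is regular if it is square and its determinant is not identically zero. -/
def IsRegular (P : MatrixPencil m n) : Prop :=
  m = n ∧ P.detPoly ≠ 0

/-- The spectrum of a regular pencil: the roots of `det P(t)`, together with `∞` if the degree of
`det P(t)` is less than the size of the pencil. -/
def spectrum (P : MatrixPencil m n) : Set (OnePoint ℂ) :=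
  {l | (∃ z : ℂ, l = (z : OnePoint ℂ) ∧ P.detPoly.IsRoot z) ∨
    (l = OnePoint.infty ∧ P.detPoly.natDegree < n)}

/-- The algebraic multiplicity of the finite number `z` as an eigenvalue of a regular pencil
(it is `0` if `z` is not an eigenvalue). -/
def algMult (P : MatrixPencil m n) (z : ℂ) : ℕ :=
  P.detPoly.rootMultiplicity z

end

end MatrixPencil

noncomputable section

/-- Inversion on `ℂ ∪ {∞}`, with `0⁻¹ = ∞` and `∞⁻¹ = 0`. -/
def extInv : OnePoint ℂ → OnePoint ℂ
  | none => ((0 : ℂ) : OnePoint ℂ)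
  | some z => if z = 0 then OnePoint.infty else ((z⁻¹ : ℂ) : OnePoint ℂ)

/-- Complex conjugation on `ℂ ∪ {∞}`, fixing `∞`. -/
def extConj : OnePoint ℂ → OnePoint ℂ
  | none => OnePoint.infty
  | some z => ((star z : ℂ) : OnePoint ℂ)

end

/-- `S` is reciprocal free: `l ≠ u⁻¹` for all `l, u ∈ S` (`l = u` is allowed). -/
def ReciprocalFree (S : Set (OnePoint ℂ)) : Prop :=
  ∀ l ∈ S, ∀ u ∈ S, l ≠ extInv u

/-- `S` is `*`-reciprocal free: `l ≠ (conj u)⁻¹` for all `l, u ∈ S` (`l = u` is allowed). -/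
def StarReciprocalFree (S : Set (OnePoint ℂ)) : Prop :=
  ∀ l ∈ S, ∀ u ∈ S, l ≠ extInv (extConj u)

/-! Write `B` for `D^⋆`, so that `D = B^⋆`. Bijectivity forces `m = n` by counting real dimensions;
for square matrices it is equivalent to injectivity and to surjectivity. An eigenvalue is handled as
a homogeneous pair `(α, β)` with `αA + βB` singular: inversion swaps `α` and `β`, and `∞` is no
longer special.

Necessity: by trace duality, surjectivity leaves `YA + Y^⋆B = 0` only the solution `Y = 0`
(`eq_zero_of_surjective_starSylvester`). Left null vectors at two reciprocal eigenvalues, or two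
independent null vectors or a Jordan chain of length two at `1`, yield a forbidden `Y` of rank at
most two.

Sufficiency: a solution of `AX = -X^⋆B^⋆` also satisfies `BX = -X^⋆A^⋆`. For generic `μ`,
eliminating `X^⋆` gives `MX = XN` with `M = (A - μB)⁻¹B` and `N = (B^⋆ - μA^⋆)⁻¹A^⋆`. A common
eigenvalue of `M` and `N` is a reciprocal pair of the pencil. For `*` there is none, so `X = 0`. For
`⊤` only the eigenvalue `1` is left; its simplicity gives `(A - B)X = 0`, and then `AX` is
skew-symmetric of rank at most one, hence zero. -/

/-! ### Transposition twisted by a field automorphism -/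

namespace Matrix

variable {ι κ τ : Type*}

/-- The transpose of `M` with the automorphism `σ` applied to every entry: `Mᵀ` if `σ` is the
identity, `Mᴴ` if `σ` is the conjugation. -/
noncomputable def twistTranspose (σ : ℂ ≃ₐ[ℝ] ℂ) (M : Matrix ι κ ℂ) : Matrix κ ι ℂ := (M.map σ)ᵀ

variable (σ : ℂ ≃ₐ[ℝ] ℂ)

@[simp]
lemma twistTranspose_apply (M : Matrix ι κ ℂ) (i : κ) (j : ι) :
    M.twistTranspose σ i j = σ (M j i) := rfl

lemma twistTranspose_refl (M : Matrix ι κ ℂ) : M.twistTranspose AlgEquiv.refl = Mᵀ := rfl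

lemma twistTranspose_conjAe (M : Matrix ι κ ℂ) : M.twistTranspose Complex.conjAe = Mᴴ := rfl

lemma twistTranspose_add (M N : Matrix ι κ ℂ) :
    (M + N).twistTranspose σ = M.twistTranspose σ + N.twistTranspose σ := by
  ext; simp

lemma twistTranspose_sub (M N : Matrix ι κ ℂ) :
    (M - N).twistTranspose σ = M.twistTranspose σ - N.twistTranspose σ := by
  ext; simp

lemma twistTranspose_neg (M : Matrix ι κ ℂ) :
    (-M).twistTranspose σ = -M.twistTranspose σ := by
  ext; simp

lemma twistTranspose_smul (c : ℂ) (M : Matrix ι κ ℂ) :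
    (c • M).twistTranspose σ = σ c • M.twistTranspose σ := by
  ext; simp

lemma twistTranspose_mul [Fintype κ] (M : Matrix ι κ ℂ) (N : Matrix κ τ ℂ) :
    (M * N).twistTranspose σ = N.twistTranspose σ * M.twistTranspose σ := by
  ext; simp [mul_apply, mul_comm]

lemma twistTranspose_twistTranspose (hσ : ∀ z, σ (σ z) = z) (M : Matrix ι κ ℂ) :
    (M.twistTranspose σ).twistTranspose σ = M := by
  ext; simp [hσ]

lemma twistTranspose_vecMulVec (v : ι → ℂ) (w : κ → ℂ) :
    (vecMulVec v w).twistTranspose σ = vecMulVec (σ ∘ w) (σ ∘ v) := by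
  ext; simp [vecMulVec_apply, mul_comm]

lemma det_twistTranspose [Fintype ι] [DecidableEq ι] (M : Matrix ι ι ℂ) :
    (M.twistTranspose σ).det = σ M.det := by
  rw [twistTranspose, det_transpose]
  exact (AlgHom.map_det (σ : ℂ →ₐ[ℝ] ℂ) M).symm

lemma trace_twistTranspose [Fintype ι] (M : Matrix ι ι ℂ) :
    (M.twistTranspose σ).trace = σ M.trace := by
  simp [trace]

/-! ### The operator of the equation -/

/-- The real-linear map `X ↦ A X + X^⋆ D`. -/
noncomputable def starSylvester [Fintype κ] (A : Matrix ι κ ℂ) (D : Matrix κ ι ℂ) :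
    Matrix κ ι ℂ →ₗ[ℝ] Matrix ι ι ℂ where
  toFun X := A * X + X.twistTranspose σ * D
  map_add' X Y := by
    rw [Matrix.mul_add, twistTranspose_add, Matrix.add_mul]; abel
  map_smul' c X := by
    have : (c • X).twistTranspose σ = c • X.twistTranspose σ := by
      ext i j
      have hc : σ (c : ℂ) = c := σ.commutes c
      simp [hc]
    rw [this]; simp

lemma starSylvester_apply [Fintype κ] (A : Matrix ι κ ℂ) (D : Matrix κ ι ℂ) (X : Matrix κ ι ℂ) :
    starSylvester σ A D X = A * X + X.twistTranspose σ * D := rfl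

lemma eq_of_bijective_starSylvester {m n : ℕ} (hm : 0 < m) {A : Matrix (Fin m) (Fin n) ℂ}
    {D : Matrix (Fin n) (Fin m) ℂ} (h : Function.Bijective (starSylvester σ A D)) : m = n := by
  have := (LinearEquiv.ofBijective _ h).finrank_eq
  simp only [Module.finrank_matrix, Fintype.card_fin, Complex.finrank_real_complex] at this
  have h2 : n * m = m * m := by omega
  exact (Nat.eq_of_mul_eq_mul_right hm h2).symm

variable [Fintype ι]

lemma bijective_starSylvester_iff (A D : Matrix ι ι ℂ) :
    Function.Bijective (starSylvester σ A D) ↔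
      ∀ X, A * X + X.twistTranspose σ * D = 0 → X = 0 := by
  rw [Function.Bijective, ← LinearMap.injective_iff_surjective, and_self,
    injective_iff_map_eq_zero]
  rfl

variable {σ} [DecidableEq ι]

/-- Such a `Y` annihilates the range under the real pairing `tr(YE) + σ(tr(YE))`, because `tr(Y X^⋆
B^⋆) = -σ(tr(YAX))`. -/
lemma eq_zero_of_surjective_starSylvester (hσ : ∀ z, σ (σ z) = z) {A B : Matrix ι ι ℂ}
    (h : Function.Surjective (starSylvester σ A (B.twistTranspose σ))) {Y : Matrix ι ι ℂ}
    (hY : Y * A + Y.twistTranspose σ * B = 0) : Y = 0 := by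
  have key (E : Matrix ι ι ℂ) : (Y * E).trace + σ (Y * E).trace = 0 := by
    obtain ⟨X, rfl⟩ := h E
    have h1 : (Y * (X.twistTranspose σ * B.twistTranspose σ)).trace
        = -σ (Y * (A * X)).trace := by
      have h2 : Y * (X.twistTranspose σ * B.twistTranspose σ)
          = (B * X * Y.twistTranspose σ).twistTranspose σ := by
        simp only [twistTranspose_mul, twistTranspose_twistTranspose σ hσ]
      have h3 : Y.twistTranspose σ * B = -(Y * A) := by
        rw [add_comm] at hY; exact eq_neg_of_add_eq_zero_left hY
      rw [h2, trace_twistTranspose, Matrix.mul_assoc, Matrix.trace_mul_comm, Matrix.mul_assoc,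
        Matrix.trace_mul_comm, Matrix.mul_assoc, ← map_neg, ← trace_neg,
        ← Matrix.mul_assoc _ B X, h3, Matrix.neg_mul, Matrix.mul_assoc]
    rw [starSylvester_apply, Matrix.mul_add, trace_add, h1]
    simp [hσ]
  ext i j
  by_contra hij
  -- This `E` makes `tr(YE) = 1`, so the pairing equals `2`.
  have := key (single j i (Y i j)⁻¹)
  rw [Matrix.trace_mul_comm] at this
  simp only [trace_single_mul] at this
  have hij' : Y i j ≠ 0 := hij
  rw [smul_eq_mul, inv_mul_cancel₀ hij', map_one] at this
  norm_num at this

end Matrix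

namespace Matrix

variable {ι : Type*} [Fintype ι] [DecidableEq ι]

/-! ### Necessity -/

section Necessity

variable {σ : ℂ ≃ₐ[ℝ] ℂ} {A B : Matrix ι ι ℂ}

lemma vecMulVec_left_null_eq_zero (hσ : ∀ z, σ (σ z) = z)
    (h : Function.Surjective (starSylvester σ A (B.twistTranspose σ))) {α β : ℂ} {v w : ι → ℂ}
    (hv : v ᵥ* (α • A + β • B) = 0) (hw : w ᵥ* (σ β • A + σ α • B) = 0) :
    α • vecMulVec (σ ∘ w) v + σ β • vecMulVec (σ ∘ v) w = 0 := by
  apply eq_zero_of_surjective_starSylvester hσ h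
  have hc (u : ι → ℂ) : σ ∘ σ ∘ u = u := funext fun i => hσ (u i)
  have e : (α • vecMulVec (σ ∘ w) v + σ β • vecMulVec (σ ∘ v) w) * A
      + (α • vecMulVec (σ ∘ w) v + σ β • vecMulVec (σ ∘ v) w).twistTranspose σ * B
      = vecMulVec (σ ∘ w) v * (α • A + β • B) + vecMulVec (σ ∘ v) w * (σ β • A + σ α • B) := by
    simp only [twistTranspose_add, twistTranspose_smul, twistTranspose_vecMulVec, hc, hσ,
      Matrix.add_mul, Matrix.mul_add, Matrix.smul_mul, Matrix.mul_smul]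
    abel
  rw [e, vecMulVec_mul, vecMulVec_mul, hv, hw]
  simp

lemma add_eq_zero_of_surjective_transpose
    (h : Function.Surjective (starSylvester AlgEquiv.refl A (B.twistTranspose AlgEquiv.refl)))
    {α β : ℂ} (h1 : (α • A + β • B).det = 0) (h2 : (β • A + α • B).det = 0) : α + β = 0 := by
  obtain ⟨v, hv, hv0⟩ := exists_vecMul_eq_zero_iff.2 h1
  obtain ⟨w, hw, hw0⟩ := exists_vecMul_eq_zero_iff.2 h2
  have key := vecMulVec_left_null_eq_zero (fun _ => rfl) h hv0 hw0
  have key' (i j : ι) : α * (w i * v j) + β * (v i * w j) = 0 := congrFun (congrFun key i) j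
  by_contra hne
  have sym (i j : ι) : w i * v j + v i * w j = 0 := by
    have : (α + β) * (w i * v j + v i * w j) = 0 := by linear_combination key' i j + key' j i
    exact (mul_eq_zero.1 this).resolve_left hne
  obtain ⟨i, hi⟩ := Function.ne_iff.1 hw
  obtain ⟨j, hj⟩ := Function.ne_iff.1 hv
  have hii : w i * v i = 0 := by linear_combination (1 / 2) * sym i i
  -- Since `w i * v j = -(v i * w j)`, the square is `-(w i * v i) * (w j * v j)`.
  have hsq : (w i * v j) * (w i * v j) = 0 := by
    linear_combination (w i * v j) * sym i j - (v j * w j) * hii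
  exact mul_ne_zero hi hj (mul_self_eq_zero.1 hsq)

lemma eq_zero_of_surjective_conjTranspose
    (h : Function.Surjective (starSylvester Complex.conjAe A (B.twistTranspose Complex.conjAe)))
    {α β : ℂ} (h1 : (α • A + β • B).det = 0) (h2 : (star β • A + star α • B).det = 0) :
    α = 0 ∧ β = 0 := by
  obtain ⟨v, hv, hv0⟩ := exists_vecMul_eq_zero_iff.2 h1
  obtain ⟨w, hw, hw0⟩ := exists_vecMul_eq_zero_iff.2 h2
  -- Replacing `w` by `I • w` multiplies the two terms of the relation by `-I` and `I`, so each of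
  -- them vanishes separately.
  have hwI : (Complex.I • w) ᵥ* (star β • A + star α • B) = 0 := by
    rw [smul_vecMul, hw0, smul_zero]
  have key := vecMulVec_left_null_eq_zero (fun z => star_star z) h hv0 hw0
  have keyI := vecMulVec_left_null_eq_zero (fun z => star_star z) h hv0 hwI
  have key' (i j : ι) : α * (star (w i) * v j) + star β * (star (v i) * w j) = 0 :=
    congrFun (congrFun key i) j
  have keyI' (i j : ι) :
      α * (star (Complex.I * w i) * v j) + star β * (star (v i) * (Complex.I * w j)) = 0 :=
    congrFun (congrFun keyI i) j
  simp only [star_mul, Complex.star_def, Complex.conj_I] at key' keyI'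
  obtain ⟨i, hi⟩ := Function.ne_iff.1 hw
  obtain ⟨j, hj⟩ := Function.ne_iff.1 hv
  constructor
  · have : 2 * α * ((starRingEnd ℂ) (w i) * v j) = 0 := by
      linear_combination key' i j + Complex.I * keyI' i j
        + (α * (starRingEnd ℂ) (w i) * v j - (starRingEnd ℂ) β * (starRingEnd ℂ) (v i) * w j)
          * Complex.I_mul_I
    simpa [show w i ≠ 0 from hi, show v j ≠ 0 from hj] using this
  · have : 2 * (starRingEnd ℂ) β * ((starRingEnd ℂ) (v j) * w i) = 0 := by
      linear_combination key' j i - Complex.I * keyI' j i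
        - (α * (starRingEnd ℂ) (w j) * v i - (starRingEnd ℂ) β * (starRingEnd ℂ) (v j) * w i)
          * Complex.I_mul_I
    simpa [show w i ≠ 0 from hi, show v j ≠ 0 from hj] using this

end Necessity

/-! ### The derivative of the determinant of a pencil -/

/-- The pencil `A - t B` as a matrix of polynomials. -/
noncomputable def pencilPoly (A B : Matrix ι ι ℂ) : Matrix ι ι ℂ[X] :=
  (X : ℂ[X]) • (-B).map C + A.map C

omit [Fintype ι] [DecidableEq ι] in
lemma pencilPoly_eval (A B : Matrix ι ι ℂ) (z : ℂ) :
    (pencilPoly A B).map (eval z) = A - z • B := by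
  ext; simp [pencilPoly]; ring

lemma eval_det_pencilPoly (A B : Matrix ι ι ℂ) (z : ℂ) :
    (pencilPoly A B).det.eval z = (A - z • B).det := by
  rw [← pencilPoly_eval A B z, ← coe_evalRingHom, RingHom.map_det]
  rfl

/-- This is the derivative at `t = 1` of `adj(A - tB) (A - tB) = det(A - tB) · 1`; it links the
multiplicity of the root `1` with null vectors and Jordan chains. -/
lemma exists_mul_sub_adjugate_mul (A B : Matrix ι ι ℂ) :
    ∃ J' : Matrix ι ι ℂ, J' * (A - B) - (A - B).adjugate * B
      = (derivative (pencilPoly A B).det).eval 1 • (1 : Matrix ι ι ℂ) := by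
  refine ⟨(pencilPoly A B).adjugate.map fun p => (derivative p).eval 1, ?_⟩
  have h1 : (pencilPoly A B).map (eval 1) = A - B := by rw [pencilPoly_eval, one_smul]
  have hJ : (A - B).adjugate = (pencilPoly A B).adjugate.map (eval 1) := by
    rw [← h1]
    exact ((evalRingHom (1 : ℂ)).map_adjugate (pencilPoly A B)).symm
  have hd (i j : ι) : (derivative (pencilPoly A B i j)).eval 1 = -B i j := by
    simp [pencilPoly]
  ext i j
  have := congrArg (fun p => (derivative p).eval 1)
    (congrFun (congrFun (adjugate_mul (pencilPoly A B)) i) j)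
  simp only [mul_apply, derivative_sum, eval_finsetSum, derivative_mul, eval_add, eval_mul,
    hd] at this
  rw [hJ, ← h1]
  simp only [sub_apply, mul_apply, map_apply, ← Finset.sum_sub_distrib]
  convert this using 1
  · exact Finset.sum_congr rfl fun k _ => by ring
  · by_cases hij : i = j <;> simp [hij]

/-! ### Singular matrices and the adjugate -/

/-- A singular matrix with vanishing adjugate has two independent left null vectors. -/
lemma exists_left_null_of_adjugate_eq_zero {T : Matrix ι ι ℂ} (hdet : T.det = 0)
    (hT : T.adjugate = 0) :
    ∃ w x : ι → ℂ, w ᵥ* T = 0 ∧ x ᵥ* T = 0 ∧ vecMulVec w x - vecMulVec x w ≠ 0 := by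
  obtain ⟨w, hw, hw0⟩ := exists_vecMul_eq_zero_iff.2 hdet
  obtain ⟨v, hv, hv0⟩ := exists_mulVec_eq_zero_iff.2 hdet
  obtain ⟨i, hi⟩ := Function.ne_iff.1 hw
  obtain ⟨j, hj⟩ := Function.ne_iff.1 hv
  -- This determinant is the `(j, i)` entry of the adjugate. A left null vector `x` of the modified
  -- matrix has `x i = 0`, hence is independent of `w`; orthogonality of `x ᵥ* T` to `v` restores
  -- the replaced column.
  have hU : (T.updateCol j (Pi.single i 1)).det = 0 := by
    rw [← cramer_apply, cramer_eq_adjugate_mulVec, hT, zero_mulVec, Pi.zero_apply]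
  obtain ⟨x, hx, hx0⟩ := exists_vecMul_eq_zero_iff.2 hU
  have hxi : x i = 0 := by
    have := congrFun hx0 j
    simpa [vecMul, dotProduct, updateCol_apply, Pi.single_apply] using this
  have hxk (k : ι) (hk : k ≠ j) : (x ᵥ* T) k = 0 := by
    have := congrFun hx0 k
    simpa [vecMul, dotProduct, updateCol_apply, hk] using this
  have hxj : (x ᵥ* T) j = 0 := by
    have h1 : (x ᵥ* T) ⬝ᵥ v = 0 := by rw [← dotProduct_mulVec, hv0, dotProduct_zero]
    rw [dotProduct, Finset.sum_eq_single j (fun k _ hk => by rw [hxk k hk, zero_mul])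
      (by simp)] at h1
    exact (mul_eq_zero.1 h1).resolve_right hj
  refine ⟨w, x, hw0, funext fun k => ?_, fun h => ?_⟩
  · by_cases hk : k = j
    · rw [hk]; exact hxj
    · exact hxk k hk
  · obtain ⟨k, hk⟩ := Function.ne_iff.1 hx
    have h1 := congrFun (congrFun h i) k
    simp only [sub_apply, vecMulVec_apply, zero_apply, hxi, zero_mul, sub_zero] at h1
    exact mul_ne_zero hi hk h1

/-- If `T` has a nonzero adjugate, its right null vectors are determined by one coordinate. -/
lemma exists_index_of_adjugate_ne_zero {T : Matrix ι ι ℂ} (hT : T.adjugate ≠ 0) :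
    ∃ j, ∀ x : ι → ℂ, T *ᵥ x = 0 → x j = 0 → x = 0 := by
  by_contra! hcon
  refine hT (ext fun j i => ?_)
  obtain ⟨x, hx0, hxj, hx⟩ := hcon j
  rw [adjugate_apply, zero_apply]
  -- The adjugate entry is the determinant of `T` with row `i` replaced by the `j`-th unit vector,
  -- and `x` lies in the kernel of that matrix.
  refine exists_mulVec_eq_zero_iff.1 ⟨x, hx, funext fun k => ?_⟩
  by_cases hk : k = i
  · simp [mulVec, updateRow_apply, hk, hxj]
  · simpa [mulVec, updateRow_apply, hk] using congrFun hx0 k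

/-- If `1` is at least a double root of `det (A - t B)`, then the operator of the transposed
equation is not surjective. -/
lemma not_surjective_of_double_root {A B : Matrix ι ι ℂ} (h0 : (A - B).det = 0)
    (h1 : (derivative (pencilPoly A B).det).eval 1 = 0) :
    ¬Function.Surjective (starSylvester AlgEquiv.refl A (B.twistTranspose AlgEquiv.refl)) := by
  intro h
  have hY {Y : Matrix ι ι ℂ} (hY : Y * A + Yᵀ * B = 0) : Y = 0 :=
    eq_zero_of_surjective_starSylvester (fun _ => rfl) h hY
  have hAB {w : ι → ℂ} (hw : w ᵥ* (A - B) = 0) : w ᵥ* A = w ᵥ* B := by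
    rwa [vecMul_sub, sub_eq_zero] at hw
  by_cases hT : (A - B).adjugate = 0
  · obtain ⟨w, x, hw, hx, hne⟩ := exists_left_null_of_adjugate_eq_zero h0 hT
    refine hne (hY ?_)
    rw [transpose_sub, transpose_vecMulVec, transpose_vecMulVec, Matrix.sub_mul, Matrix.sub_mul]
    simp only [vecMulVec_mul, hAB hw, hAB hx]
    abel
  · obtain ⟨J', hJ'⟩ := exists_mul_sub_adjugate_mul A B
    rw [h1, zero_smul, sub_eq_zero] at hJ'
    obtain ⟨i, k, hik⟩ : ∃ i k, (A - B).adjugate i k ≠ 0 := by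
      by_contra! hcon
      exact hT (ext hcon)
    obtain ⟨w, hwdef⟩ : ∃ w, w = (A - B).adjugate i := ⟨_, rfl⟩
    have hw : w ᵥ* (A - B) = 0 := by
      have := adjugate_mul (A - B)
      rw [h0, zero_smul] at this
      rw [hwdef]
      exact congrFun this i
    -- The rows `w` and `z = J' i` form a left Jordan chain at `1`.
    have hz : J' i ᵥ* (A - B) = w ᵥ* B := by
      rw [hwdef]; exact congrFun hJ' i
    rw [vecMul_sub, sub_eq_iff_eq_add] at hz
    -- The skew part leaves the remainder `-w (wB)`, which the symmetric term with factor `1 / 2`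
    -- cancels. The diagonal of `Y` is that of the symmetric term alone.
    have := hY (Y := vecMulVec (J' i) w - vecMulVec w (J' i) + (1 / 2 : ℂ) • vecMulVec w w) (by
      simp only [transpose_add, transpose_sub, transpose_smul, transpose_vecMulVec,
        Matrix.add_mul, Matrix.sub_mul, Matrix.smul_mul, vecMulVec_mul, hAB hw, hz, vecMulVec_add]
      ext a b
      simp only [add_apply, sub_apply, smul_apply, zero_apply, smul_eq_mul]
      ring)
    have hkk := congrFun (congrFun this k) k
    simp only [add_apply, sub_apply, smul_apply, zero_apply, smul_eq_mul, vecMulVec_apply] at hkk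
    have hwk : w k * w k = 0 := by linear_combination 2 * hkk
    exact hik ((congrFun hwdef k).symm.trans (mul_self_eq_zero.1 hwk))

end Matrix

namespace Matrix

variable {ι : Type*} [Fintype ι] [DecidableEq ι]

/-! ### Sufficiency -/

lemma eq_zero_of_mul_eq_zero_of_det_ne_zero {W Y : Matrix ι ι ℂ} (hW : W.det ≠ 0)
    (h : W * Y = 0) : Y = 0 := by
  have := nonsing_inv_mul_cancel_left W Y (isUnit_iff_ne_zero.2 hW)
  rw [← this, h, Matrix.mul_zero]

/-- If `M X = X N` and, for every eigenvalue `ν` of `N`, the matrix `M - ν` may be cancelled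
after `Z`, then `Z X = 0`. -/
lemma mul_eq_zero_of_intertwine {M N X Z : Matrix ι ι ℂ} (hMX : M * X = X * N)
    (hZ : ∀ ν : ℂ, (ν • (1 : Matrix ι ι ℂ) - N).det = 0 →
      ∀ Y, Z * ((M - ν • (1 : Matrix ι ι ℂ)) * Y) = 0 → Z * Y = 0) :
    Z * X = 0 := by
  have hpow (k : ℕ) : M ^ k * X = X * N ^ k := by
    induction k with
    | zero => simp
    | succ k ih => rw [pow_succ, Matrix.mul_assoc, hMX, ← Matrix.mul_assoc, ih, pow_succ,
        Matrix.mul_assoc]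
  have hpoly (p : ℂ[X]) : aeval M p * X = X * aeval N p := by
    induction p using Polynomial.induction_on' with
    | add p q hp hq => rw [map_add, map_add, Matrix.add_mul, Matrix.mul_add, hp, hq]
    | monomial k a =>
      simp only [aeval_monomial, Algebra.algebraMap_eq_smul_one, smul_one_mul, Matrix.smul_mul,
        Matrix.mul_smul, hpow]
  have hprod (s : Multiset ℂ) (hs : ∀ ν ∈ s, (ν • (1 : Matrix ι ι ℂ) - N).det = 0) :
      ∀ Y, aeval M (s.map fun ν => (Polynomial.X - C ν : ℂ[X])).prod * Y = 0 → Z * Y = 0 := by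
    induction s using Multiset.induction_on with
    | empty => intro Y hY; simpa using congrArg (Z * ·) hY
    | cons ν s ih =>
      intro Y hY
      refine hZ ν (hs ν (Multiset.mem_cons_self ν s)) Y
        (ih (fun ν' h => hs ν' (Multiset.mem_cons_of_mem h)) _ ?_)
      rw [Multiset.map_cons, Multiset.prod_cons, mul_comm, map_mul, Matrix.mul_assoc] at hY
      rw [← hY]
      simp [Algebra.algebraMap_eq_smul_one]
  -- By Cayley–Hamilton, `χ_N(M) X = X χ_N(N) = 0`; the linear factors of `χ_N(M)` are then
  -- cancelled one by one.
  refine hprod N.charpoly.roots (fun ν hν => ?_) X ?_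
  · have := isRoot_of_mem_roots hν
    rwa [IsRoot, eval_charpoly, scalar_apply, ← smul_one_eq_diagonal] at this
  · rw [← (IsAlgClosed.splits N.charpoly).eq_prod_roots_of_monic N.charpoly_monic, hpoly,
      aeval_self_charpoly, Matrix.mul_zero]

/-- For `z ≠ 0`, `det(A - zB)` is a multiple of `det(B - z⁻¹A)`. -/
lemma pencilPoly_det_swap_ne_zero {A B : Matrix ι ι ℂ} (h : (pencilPoly A B).det ≠ 0) :
    (pencilPoly B A).det ≠ 0 := by
  intro h0
  apply h
  apply eq_zero_of_infinite_isRoot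
  refine Set.Infinite.mono (s := {0}ᶜ) (fun z hz => ?_) (Set.finite_singleton 0).infinite_compl
  have hz : z ≠ 0 := hz
  have h1 := eval_det_pencilPoly B A z⁻¹
  rw [h0, eval_zero] at h1
  have h2 : A - z • B = (-z) • (B - z⁻¹ • A) := by
    rw [smul_sub, smul_smul, neg_mul, mul_inv_cancel₀ hz]
    module
  change (pencilPoly A B).det.eval z = 0
  rw [eval_det_pencilPoly, h2, det_smul, ← h1, mul_zero]

variable {σ : ℂ ≃ₐ[ℝ] ℂ} {A B X : Matrix ι ι ℂ}

lemma exists_regular_shift (h : (pencilPoly A B).det ≠ 0) :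
    ∃ μ : ℂ, (A - μ • B).det ≠ 0 ∧
      (B.twistTranspose σ - μ • A.twistTranspose σ).det ≠ 0 := by
  have f1 := finite_setOfPred_isRoot h
  have f2 := finite_setOfPred_isRoot (pencilPoly_det_swap_ne_zero h)
  obtain ⟨μ, hμ⟩ := (f1.union (f2.image σ)).infinite_compl.nonempty
  simp only [Set.mem_compl_iff, Set.mem_union, not_or, Set.mem_ofPred_eq] at hμ
  refine ⟨μ, fun h0 => hμ.1 ((eval_det_pencilPoly A B μ).trans h0), fun h0 => hμ.2
    ⟨σ.symm μ, (eval_det_pencilPoly B A _).trans ?_, σ.apply_symm_apply μ⟩⟩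
  have : B.twistTranspose σ - μ • A.twistTranspose σ
      = (B - σ.symm μ • A).twistTranspose σ := by
    rw [twistTranspose_sub, twistTranspose_smul, σ.apply_symm_apply]
  rwa [this, det_twistTranspose, map_eq_zero_iff σ σ.injective] at h0

/-- Eliminating `X^⋆` yields the intertwining relation `MX = XN`. The hypothesis on `ν` says that
`ν` is an eigenvalue of `N`, rewritten in terms of `A` and `B`. The matrix `Z` allows for a common
eigenvalue of `M` and `N`. -/
lemma mul_eq_zero_of_solution (hσ : ∀ z, σ (σ z) = z)
    (hX : A * X + X.twistTranspose σ * B.twistTranspose σ = 0) {μ : ℂ}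
    (hP : (A - μ • B).det ≠ 0) (hQ : (B.twistTranspose σ - μ • A.twistTranspose σ).det ≠ 0)
    {Z : Matrix ι ι ℂ}
    (hZ : ∀ ν : ℂ, (σ (1 + ν * μ) • A + σ (-ν) • B).det = 0 →
      ∀ Y, Z * (((A - μ • B)⁻¹ * B - ν • (1 : Matrix ι ι ℂ)) * Y) = 0 → Z * Y = 0) :
    Z * X = 0 := by
  have hX' : B * X + X.twistTranspose σ * A.twistTranspose σ = 0 := by
    have := congrArg (twistTranspose σ) hX
    simp only [twistTranspose_add, twistTranspose_mul, twistTranspose_twistTranspose σ hσ] at this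
    rw [add_comm, this]
    ext; simp
  have uP := isUnit_iff_ne_zero.2 hP
  have uQ := isUnit_iff_ne_zero.2 hQ
  obtain ⟨P, hPd⟩ : ∃ P, P = A - μ • B := ⟨_, rfl⟩
  obtain ⟨Q, hQd⟩ : ∃ Q, Q = B.twistTranspose σ - μ • A.twistTranspose σ := ⟨_, rfl⟩
  have hPX : P * X = -(X.twistTranspose σ * Q) := by
    rw [hPd, hQd, Matrix.sub_mul, Matrix.mul_sub, Matrix.smul_mul, Matrix.mul_smul,
      eq_neg_of_add_eq_zero_left hX, eq_neg_of_add_eq_zero_left hX']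
    module
  rw [← hPd] at hZ uP
  rw [← hQd] at uQ hQ
  refine mul_eq_zero_of_intertwine (M := P⁻¹ * B) (N := Q⁻¹ * A.twistTranspose σ) ?_
    (fun ν hν => hZ ν ?_)
  · have h1 : X.twistTranspose σ = -(P * X * Q⁻¹) := by
      rw [hPX, Matrix.neg_mul, neg_neg, mul_nonsing_inv_cancel_right _ _ uQ]
    rw [Matrix.mul_assoc, eq_neg_of_add_eq_zero_left hX', h1, Matrix.neg_mul, neg_neg,
      Matrix.mul_assoc, Matrix.mul_assoc, nonsing_inv_mul_cancel_left _ _ uP]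
  · have h1 : (Q * (ν • (1 : Matrix ι ι ℂ) - Q⁻¹ * A.twistTranspose σ)).det = 0 := by
      rw [det_mul, hν, mul_zero]
    have h2 : Q * (ν • (1 : Matrix ι ι ℂ) - Q⁻¹ * A.twistTranspose σ)
        = -(σ (1 + ν * μ) • A + σ (-ν) • B).twistTranspose σ := by
      rw [Matrix.mul_sub, mul_nonsing_inv_cancel_left _ _ uQ, hQd, Matrix.mul_smul,
        Matrix.mul_one, twistTranspose_add, twistTranspose_smul, twistTranspose_smul, hσ, hσ]
      module
    rw [h2, ← twistTranspose_neg, det_twistTranspose, map_eq_zero_iff σ σ.injective,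
      det_neg] at h1
    exact (mul_eq_zero.1 h1).resolve_left (pow_ne_zero _ (by norm_num))

lemma mul_inv_mul_sub {μ ν : ℂ} (hP : (A - μ • B).det ≠ 0) :
    (A - μ • B) * ((A - μ • B)⁻¹ * B - ν • (1 : Matrix ι ι ℂ))
      = (-ν) • A + (1 + ν * μ) • B := by
  rw [Matrix.mul_sub, mul_nonsing_inv_cancel_left _ _ (isUnit_iff_ne_zero.2 hP),
    Matrix.mul_smul, Matrix.mul_one]
  module

lemma eq_zero_of_conjTranspose_solution (hreg : (pencilPoly A B).det ≠ 0)
    (H : ∀ α β : ℂ, (α • A + β • B).det = 0 → (star β • A + star α • B).det = 0 →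
      α = 0 ∧ β = 0)
    (hX : A * X + X.twistTranspose Complex.conjAe * B.twistTranspose Complex.conjAe = 0) :
    X = 0 := by
  obtain ⟨μ, hP, hQ⟩ := exists_regular_shift (σ := Complex.conjAe) hreg
  rw [← Matrix.one_mul X]
  refine mul_eq_zero_of_solution (fun z => star_star z) hX hP hQ fun ν hν Y hY => ?_
  rw [Matrix.one_mul] at hY ⊢
  refine eq_zero_of_mul_eq_zero_of_det_ne_zero (fun h0 => ?_) hY
  -- The pair `(-ν, 1 + νμ)` is never `(0, 0)`.
  obtain ⟨h1, h2⟩ := H (-ν) (1 + ν * μ)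
    (by rw [← mul_inv_mul_sub hP, det_mul, h0, mul_zero]) hν
  rw [neg_eq_zero] at h1
  simp [h1] at h2

lemma eq_zero_of_transpose_solution (hreg : (pencilPoly A B).det ≠ 0)
    (H : ∀ α β : ℂ, (α • A + β • B).det = 0 → (β • A + α • B).det = 0 → α + β = 0)
    (hc : (A - B).det ≠ 0 ∨ (derivative (pencilPoly A B).det).eval 1 ≠ 0)
    (hX : A * X + X.twistTranspose AlgEquiv.refl * B.twistTranspose AlgEquiv.refl = 0) :
    X = 0 := by
  obtain ⟨μ, hP, hQ⟩ := exists_regular_shift (σ := AlgEquiv.refl) hreg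
  have hAB {W : Matrix ι ι ℂ} (hW : (A - B) * W = 0) : A * W = B * W := by
    rwa [Matrix.sub_mul, sub_eq_zero] at hW
  have uP := isUnit_iff_ne_zero.2 hP
  -- null vectors of `A - B` are detected by `adj (A - B) B`
  have hker {W : Matrix ι ι ℂ} (hW : (A - B) * W = 0)
      (hJ : (A - B).det = 0 → (A - B).adjugate * (B * W) = 0) : W = 0 := by
    rcases eq_or_ne (A - B).det 0 with h0 | h0
    · obtain ⟨J', hJ'⟩ := exists_mul_sub_adjugate_mul A B
      have h1 := congrArg (· * W) hJ'
      simp only [Matrix.sub_mul _ _ W, Matrix.mul_assoc, hAB hW, hJ h0, sub_self, Matrix.mul_zero,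
        Matrix.smul_mul, Matrix.one_mul] at h1
      exact (smul_eq_zero.1 h1.symm).resolve_left (hc.resolve_left (not_not.2 h0))
    · exact eq_zero_of_mul_eq_zero_of_det_ne_zero h0 hW
  -- With this `Z`, a factor `M - ν` at the eigenvalue `1` of the pencil is a multiple of `Z`, so
  -- cancelling it means that `Z * Z * Y = 0` implies `Z * Y = 0`; this is where simplicity enters.
  -- Any other factor is invertible and commutes with `Z`.
  have hZX : ((A - μ • B)⁻¹ * (A - B)) * X = 0 := by
    refine mul_eq_zero_of_solution (fun _ => rfl) hX hP hQ fun ν hν Y hY => ?_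
    have hM := mul_inv_mul_sub (ν := ν) hP
    rcases eq_or_ne ((A - μ • B)⁻¹ * B - ν • (1 : Matrix ι ι ℂ)).det 0 with h0 | h0
    · have hαβ := H (-ν) (1 + ν * μ) (by rw [← hM, det_mul, h0, mul_zero]) hν
      have hν0 : ν ≠ 0 := by rintro rfl; simp at hαβ
      have hμ : 1 - μ ≠ 0 := by
        intro h; apply one_ne_zero (α := ℂ); linear_combination hαβ + ν * h
      have hM' : (A - μ • B)⁻¹ * B - ν • (1 : Matrix ι ι ℂ)
          = (-ν) • ((A - μ • B)⁻¹ * (A - B)) := by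
        rw [← nonsing_inv_mul_cancel_left (A - μ • B) (_ - _) uP, hM,
          show 1 + ν * μ = ν by linear_combination hαβ, ← Matrix.mul_smul]
        congr 1
        module
      obtain ⟨W, hWd⟩ : ∃ W, W = (A - μ • B)⁻¹ * (A - B) * Y := ⟨_, rfl⟩
      rw [hM', Matrix.smul_mul, Matrix.mul_smul, ← hWd] at hY
      have hPW : (A - μ • B) * W = (A - B) * Y := by
        rw [hWd, Matrix.mul_assoc, mul_nonsing_inv_cancel_left _ _ uP]
      have hTW : (A - B) * W = 0 := by
        have := (smul_eq_zero.1 hY).resolve_left (neg_ne_zero.2 hν0)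
        rw [← mul_nonsing_inv_cancel_left (A - μ • B) ((A - B) * W) uP, ← Matrix.mul_assoc _⁻¹,
          this, Matrix.mul_zero]
      rw [← hWd]
      refine hker hTW fun hdet => ?_
      have h1 : (A - μ • B) * W = (1 - μ) • (B * W) := by
        rw [Matrix.sub_mul, hAB hTW, Matrix.smul_mul]; module
      -- Up to the factor `1 - μ`, `B * W` lies in the range of `A - B`, which the adjugate
      -- annihilates when the determinant is zero.
      have h2 : (A - B).adjugate * ((1 - μ) • (B * W)) = 0 := by
        rw [← h1, hPW, ← Matrix.mul_assoc, adjugate_mul, hdet, zero_smul, Matrix.zero_mul]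
      rw [Matrix.mul_smul] at h2
      exact (smul_eq_zero.1 h2).resolve_left hμ
    · have hcomm : Commute ((A - μ • B)⁻¹ * (A - B))
          ((A - μ • B)⁻¹ * B - ν • (1 : Matrix ι ι ℂ)) := by
        have e : (A - μ • B)⁻¹ * (A - B) = 1 + (μ - 1) • ((A - μ • B)⁻¹ * B) := by
          have e1 : (A - μ • B)⁻¹ * (A - μ • B) = 1 := nonsing_inv_mul _ uP
          rw [← e1, ← Matrix.mul_smul, ← Matrix.mul_add]
          congr 1
          module
        rw [e]
        have h1 : Commute ((A - μ • B)⁻¹ * B) ((A - μ • B)⁻¹ * B - ν • (1 : Matrix ι ι ℂ)) :=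
          (Commute.refl _).sub_right ((Commute.one_right _).smul_right ν)
        exact (Commute.one_left _).add_left (h1.smul_left (μ - 1))
      rw [← Matrix.mul_assoc, hcomm.eq, Matrix.mul_assoc] at hY
      exact eq_zero_of_mul_eq_zero_of_det_ne_zero h0 hY
  have hTX : (A - B) * X = 0 := by
    rw [← mul_nonsing_inv_cancel_left (A - μ • B) ((A - B) * X) uP, ← Matrix.mul_assoc _⁻¹, hZX,
      Matrix.mul_zero]
  by_cases hadj : (A - B).adjugate = 0
  · exact hker hTX fun _ => by rw [hadj, Matrix.zero_mul]
  obtain ⟨j, hj⟩ := exists_index_of_adjugate_ne_zero hadj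
  have hcol (x : ι → ℂ) : (A - B) *ᵥ (X *ᵥ x) = 0 := by
    rw [mulVec_mulVec, hTX, zero_mulVec]
  by_cases hrow : ∀ l, X j l = 0
  · ext k l
    have h1 := hj (X *ᵥ Pi.single l 1) (hcol _) (by simpa using hrow l)
    simpa using congrFun h1 k
  push Not at hrow
  obtain ⟨r, hr⟩ := hrow
  -- Null vectors of `A - B` are determined by coordinate `j`, so all columns of `X` are
  -- proportional.
  have hprop (l : ι) : X j r • (X *ᵥ Pi.single l 1) = X j l • (X *ᵥ Pi.single r 1) := by
    have h1 := hj (X *ᵥ (X j r • Pi.single l 1 - X j l • Pi.single r 1)) (hcol _)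
      (by simp [mulVec_sub, mulVec_smul]; ring)
    rwa [mulVec_sub, mulVec_smul, mulVec_smul, sub_eq_zero] at h1
  obtain ⟨S, hS⟩ : ∃ S, S = A * X := ⟨_, rfl⟩
  have hSprop (k l : ι) : X j r * S k l = X j l * S k r := by
    have h1 := congrFun (congrArg (A *ᵥ ·) (hprop l)) k
    simp only [mulVec_smul, mulVec_single_one, Pi.smul_apply, smul_eq_mul] at h1
    rw [hS]
    exact h1
  have hanti (k l : ι) : S k l = -S l k := by
    have h1 : S = -Sᵀ := by
      conv_rhs => rw [hS, hAB hTX, transpose_mul]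
      rw [hS]
      exact eq_neg_of_add_eq_zero_left hX
    exact congrFun (congrFun h1 k) l
  have hS0 : S = 0 := by
    ext k l
    have hd (k : ι) : S k k = 0 := by linear_combination (1 / 2) * hanti k k
    have hk : X j k * S k r = 0 := by rw [← hSprop, hd, mul_zero]
    -- A skew-symmetric matrix of rank at most one is zero: by antisymmetry and proportionality the
    -- square is `-(X j l * S k r) * (X j k * S l r)`, and `X j k * S k r = X j r * S k k = 0`.
    have h1 : (X j r * S k l) * (X j r * S k l) = 0 := by
      linear_combination (X j r * S k l) * X j r * hanti k l - (X j r * S l k) * hSprop k l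
        - (X j l * S k r) * hSprop l k - (X j l * S l r) * hk
    exact (mul_eq_zero.1 (mul_self_eq_zero.1 h1)).resolve_left hr
  refine eq_zero_of_mul_eq_zero_of_det_ne_zero hP ?_
  rw [Matrix.sub_mul, Matrix.smul_mul, ← hAB hTX, ← hS, hS0, smul_zero, sub_zero]

end Matrix

/-! ### Homogeneous coordinates on the extended plane -/

/-- The point `-β / α` of the extended plane, the one with homogeneous coordinates `(-β : α)`. -/
noncomputable def homPoint (α β : ℂ) : OnePoint ℂ :=
  if α = 0 then OnePoint.infty else ((-β / α : ℂ) : OnePoint ℂ)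

lemma homPoint_of_ne_zero {α : ℂ} (h : α ≠ 0) (β : ℂ) :
    homPoint α β = ((-β / α : ℂ) : OnePoint ℂ) := if_neg h

lemma homPoint_zero (β : ℂ) : homPoint 0 β = OnePoint.infty := if_pos rfl

lemma exists_homPoint (l : OnePoint ℂ) : ∃ α β : ℂ, (α ≠ 0 ∨ β ≠ 0) ∧ l = homPoint α β := by
  induction l using OnePoint.rec with
  | infty => exact ⟨0, 1, by simp, (homPoint_zero 1).symm⟩
  | coe z => exact ⟨1, -z, by simp, by simp [homPoint_of_ne_zero]⟩

lemma extInv_coe (z : ℂ) :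
    extInv (z : OnePoint ℂ) = if z = 0 then OnePoint.infty else ((z⁻¹ : ℂ) : OnePoint ℂ) := rfl

lemma extInv_homPoint {α β : ℂ} (h : α ≠ 0 ∨ β ≠ 0) :
    extInv (homPoint α β) = homPoint β α := by
  rcases eq_or_ne α 0 with rfl | hα
  · have hβ : β ≠ 0 := by simpa using h
    rw [homPoint_zero, homPoint_of_ne_zero hβ, neg_zero, zero_div]
    rfl
  · rw [homPoint_of_ne_zero hα, extInv_coe]
    rcases eq_or_ne β 0 with rfl | hβ
    · simp [homPoint_zero]
    · have : -β / α ≠ 0 := div_ne_zero (neg_ne_zero.2 hβ) hα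
      rw [if_neg this, homPoint_of_ne_zero hβ, OnePoint.coe_eq_coe]
      field_simp

lemma extConj_homPoint (α β : ℂ) : extConj (homPoint α β) = homPoint (star α) (star β) := by
  rcases eq_or_ne α 0 with rfl | hα
  · rw [star_zero, homPoint_zero, homPoint_zero]
    rfl
  · have hα' : star α ≠ 0 := star_ne_zero.2 hα
    rw [homPoint_of_ne_zero hα, homPoint_of_ne_zero hα']
    change ((star (-β / α) : ℂ) : OnePoint ℂ) = _
    rw [OnePoint.coe_eq_coe]
    simp

lemma homPoint_eq_one_iff {α β : ℂ} (h : α ≠ 0 ∨ β ≠ 0) :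
    homPoint α β = ((1 : ℂ) : OnePoint ℂ) ↔ α + β = 0 := by
  rcases eq_or_ne α 0 with rfl | hα
  · have hβ : β ≠ 0 := by simpa using h
    simp [homPoint_zero, hβ]
  · rw [homPoint_of_ne_zero hα, OnePoint.coe_eq_coe, div_eq_one_iff_eq hα, neg_eq_iff_add_eq_zero,
      add_comm]

lemma reciprocalFree_iff (S : Set (OnePoint ℂ)) :
    ReciprocalFree S ↔ ∀ α β : ℂ, α ≠ 0 ∨ β ≠ 0 → homPoint α β ∈ S → homPoint β α ∉ S := by
  constructor
  · intro h α β h0 h1 h2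
    exact h _ h2 _ h1 (extInv_homPoint h0).symm
  · rintro h l hl u hu rfl
    obtain ⟨α, β, h0, rfl⟩ := exists_homPoint u
    rw [extInv_homPoint h0] at hl
    exact h α β h0 hu hl

lemma starReciprocalFree_iff (S : Set (OnePoint ℂ)) :
    StarReciprocalFree S ↔
      ∀ α β : ℂ, α ≠ 0 ∨ β ≠ 0 → homPoint α β ∈ S → homPoint (star β) (star α) ∉ S := by
  have hs {α β : ℂ} (h0 : α ≠ 0 ∨ β ≠ 0) : star α ≠ 0 ∨ star β ≠ 0 := by simpa using h0
  constructor
  · intro h α β h0 h1 h2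
    refine h _ h2 _ h1 ?_
    rw [extConj_homPoint, extInv_homPoint (hs h0)]
  · rintro h l hl u hu rfl
    obtain ⟨α, β, h0, rfl⟩ := exists_homPoint u
    rw [extConj_homPoint, extInv_homPoint (hs h0)] at hl
    exact h α β h0 hu hl

/-! ### The spectrum of a square pencil -/

namespace MatrixPencil

variable {n : ℕ} (A B : Matrix (Fin n) (Fin n) ℂ)

lemma detPoly_eq : (MatrixPencil.mk (-B) A).detPoly = (pencilPoly A B).det := by
  rw [detPoly, dif_pos rfl]
  rfl

lemma isRegular_iff : (MatrixPencil.mk (-B) A).IsRegular ↔ (pencilPoly A B).det ≠ 0 := by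
  rw [IsRegular, detPoly_eq]
  simp

lemma coe_mem_spectrum_iff (z : ℂ) :
    (z : OnePoint ℂ) ∈ (MatrixPencil.mk (-B) A).spectrum ↔ (A - z • B).det = 0 := by
  rw [← eval_det_pencilPoly, spectrum, detPoly_eq]
  simp [IsRoot]

lemma det_neg_eq_zero_iff : (-B).det = 0 ↔ B.det = 0 := by
  rw [det_neg]
  simp

lemma infty_mem_spectrum_iff (hn : 0 < n) :
    OnePoint.infty ∈ (MatrixPencil.mk (-B) A).spectrum ↔ B.det = 0 := by
  have h1 : (pencilPoly A B).det.natDegree ≤ n := by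
    simpa [pencilPoly] using natDegree_det_X_add_C_le (-B) A
  have h2 : (pencilPoly A B).det.coeff n = (-B).det := by
    simpa [pencilPoly] using coeff_det_X_add_C_card (-B) A
  have h3 : OnePoint.infty ∈ (MatrixPencil.mk (-B) A).spectrum ↔
      (pencilPoly A B).det.natDegree < n := by
    rw [spectrum, detPoly_eq]
    simp
  rw [h3, ← det_neg_eq_zero_iff, ← h2]
  refine ⟨coeff_eq_zero_of_natDegree_lt, fun h => lt_of_le_of_ne h1 fun he => ?_⟩
  -- Degree exactly `n` with vanishing `n`-th coefficient forces the zero polynomial, whose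
  -- `natDegree` is `0 < n`.
  have : (pencilPoly A B).det = 0 := by
    rw [← leadingCoeff_eq_zero, leadingCoeff, he, h]
  rw [this, natDegree_zero] at he
  omega

lemma homPoint_mem_spectrum_iff (hn : 0 < n) {α β : ℂ} (h : α ≠ 0 ∨ β ≠ 0) :
    homPoint α β ∈ (MatrixPencil.mk (-B) A).spectrum ↔ (α • A + β • B).det = 0 := by
  rcases eq_or_ne α 0 with rfl | hα
  · have hβ : β ≠ 0 := by simpa using h
    rw [homPoint_zero, infty_mem_spectrum_iff A B hn, zero_smul, zero_add, det_smul]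
    simp [hβ]
  · have : α • A + β • B = α • (A - (-β / α) • B) := by
      rw [smul_sub, smul_smul, mul_div_cancel₀ _ hα]
      module
    rw [homPoint_of_ne_zero hα, coe_mem_spectrum_iff, this, det_smul]
    simp [hα]

lemma reciprocalFree_spectrum_diff_one_iff (hn : 0 < n) :
    ReciprocalFree ((MatrixPencil.mk (-B) A).spectrum \ {((1 : ℂ) : OnePoint ℂ)}) ↔
      ∀ α β : ℂ, (α • A + β • B).det = 0 → (β • A + α • B).det = 0 → α + β = 0 := by
  rw [reciprocalFree_iff]
  have key {α β : ℂ} (h : α ≠ 0 ∨ β ≠ 0) :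
      homPoint α β ∈ (MatrixPencil.mk (-B) A).spectrum \ {((1 : ℂ) : OnePoint ℂ)} ↔
        (α • A + β • B).det = 0 ∧ α + β ≠ 0 := by
    rw [Set.mem_sdiff, Set.mem_singleton_iff, homPoint_mem_spectrum_iff A B hn h,
      homPoint_eq_one_iff h]
  constructor
  · intro H α β h1 h2
    by_contra h3
    have h0 : α ≠ 0 ∨ β ≠ 0 := by
      by_contra! h; exact h3 (by rw [h.1, h.2, add_zero])
    exact H α β h0 ((key h0).2 ⟨h1, h3⟩) ((key h0.symm).2 ⟨h2, by rwa [add_comm]⟩)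
  · intro H α β h0 h1 h2
    rw [key h0] at h1
    rw [key h0.symm] at h2
    exact h1.2 (H α β h1.1 h2.1)

lemma starReciprocalFree_spectrum_iff (hn : 0 < n) :
    StarReciprocalFree (MatrixPencil.mk (-B) A).spectrum ↔
      ∀ α β : ℂ, (α • A + β • B).det = 0 → (star β • A + star α • B).det = 0 →
        α = 0 ∧ β = 0 := by
  rw [starReciprocalFree_iff]
  have hs {α β : ℂ} (h0 : α ≠ 0 ∨ β ≠ 0) : star β ≠ 0 ∨ star α ≠ 0 := by
    simpa using h0.symm
  constructor
  · intro H α β h1 h2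
    by_contra h3
    have h0 : α ≠ 0 ∨ β ≠ 0 := by
      by_contra! h; exact h3 h
    exact H α β h0 ((homPoint_mem_spectrum_iff A B hn h0).2 h1)
      ((homPoint_mem_spectrum_iff A B hn (hs h0)).2 h2)
  · intro H α β h0 h1 h2
    rw [homPoint_mem_spectrum_iff A B hn h0] at h1
    rw [homPoint_mem_spectrum_iff A B hn (hs h0)] at h2
    obtain ⟨h3, h4⟩ := H α β h1 h2
    simp [h3, h4] at h0

variable {A B}

lemma algMult_one_le_one_iff (h : (pencilPoly A B).det ≠ 0) :
    (MatrixPencil.mk (-B) A).algMult 1 ≤ 1 ↔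
      (A - B).det ≠ 0 ∨ (derivative (pencilPoly A B).det).eval 1 ≠ 0 := by
  rw [algMult, detPoly_eq, ← not_lt, one_lt_rootMultiplicity_iff_isRoot h, IsRoot, IsRoot,
    eval_det_pencilPoly, one_smul, not_and_or]

lemma det_pencilPoly_ne_zero (h : ¬(A.det = 0 ∧ B.det = 0)) (hn : 0 < n) :
    (pencilPoly A B).det ≠ 0 := by
  intro h0
  refine h ⟨?_, ?_⟩
  · have := eval_det_pencilPoly A B 0
    rwa [h0, eval_zero, zero_smul, sub_zero, eq_comm] at this
  · rw [← infty_mem_spectrum_iff A B hn, spectrum, detPoly_eq, h0]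
    simp [hn]

end MatrixPencil

/-! ### The main theorem -/

lemma bijective_starSylvester_transpose_iff {n : ℕ} (hn : 0 < n)
    (A B : Matrix (Fin n) (Fin n) ℂ) :
    Function.Bijective (starSylvester AlgEquiv.refl A (B.twistTranspose AlgEquiv.refl)) ↔
      (MatrixPencil.mk (-B) A).IsRegular ∧
      ReciprocalFree ((MatrixPencil.mk (-B) A).spectrum \ {((1 : ℂ) : OnePoint ℂ)}) ∧
      (MatrixPencil.mk (-B) A).algMult 1 ≤ 1 := by
  rw [MatrixPencil.isRegular_iff, MatrixPencil.reciprocalFree_spectrum_diff_one_iff A B hn]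
  constructor
  · intro h
    have H (α β : ℂ) (h1 : (α • A + β • B).det = 0) (h2 : (β • A + α • B).det = 0) : α + β = 0 :=
      add_eq_zero_of_surjective_transpose h.2 h1 h2
    have hreg : (pencilPoly A B).det ≠ 0 :=
      MatrixPencil.det_pencilPoly_ne_zero
        -- If `A` and `B` were both singular, `0` and `∞` would be a reciprocal pair of eigenvalues.
        (fun h0 => by simpa using H 1 0 (by simp [h0.1]) (by simp [h0.2])) hn
    refine ⟨hreg, H, (MatrixPencil.algMult_one_le_one_iff hreg).2 ?_⟩
    by_contra! hcon
    exact not_surjective_of_double_root hcon.1 hcon.2 h.2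
  · rintro ⟨hreg, H, hmult⟩
    rw [bijective_starSylvester_iff]
    exact fun X hX => eq_zero_of_transpose_solution hreg H
      ((MatrixPencil.algMult_one_le_one_iff hreg).1 hmult) hX

lemma bijective_starSylvester_conjTranspose_iff {n : ℕ} (hn : 0 < n)
    (A B : Matrix (Fin n) (Fin n) ℂ) :
    Function.Bijective (starSylvester Complex.conjAe A (B.twistTranspose Complex.conjAe)) ↔
      (MatrixPencil.mk (-B) A).IsRegular ∧
      StarReciprocalFree (MatrixPencil.mk (-B) A).spectrum := by
  rw [MatrixPencil.isRegular_iff, MatrixPencil.starReciprocalFree_spectrum_iff A B hn]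
  constructor
  · intro h
    have H (α β : ℂ) (h1 : (α • A + β • B).det = 0) (h2 : (star β • A + star α • B).det = 0) :
        α = 0 ∧ β = 0 := eq_zero_of_surjective_conjTranspose h.2 h1 h2
    exact ⟨MatrixPencil.det_pencilPoly_ne_zero
      (fun h0 => by simpa using H 1 0 (by simp [h0.1]) (by simp [h0.2])) hn, H⟩
  · rintro ⟨hreg, H⟩
    rw [bijective_starSylvester_iff]
    exact fun X hX => eq_zero_of_conjTranspose_solution hreg H hX

theorem mainTheorem3 (m n : ℕ) (hm : 0 < m)
    (A : Matrix (Fin m) (Fin n) ℂ) (D : Matrix (Fin n) (Fin m) ℂ) :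
    ((∀ E : Matrix (Fin m) (Fin m) ℂ, ∃! X : Matrix (Fin n) (Fin m) ℂ, A * X + Xᵀ * D = E) ↔
      (MatrixPencil.mk (-Dᵀ) A).IsRegular ∧
      ReciprocalFree ((MatrixPencil.mk (-Dᵀ) A).spectrum \ {((1 : ℂ) : OnePoint ℂ)}) ∧
      (MatrixPencil.mk (-Dᵀ) A).algMult 1 ≤ 1) ∧
    ((∀ E : Matrix (Fin m) (Fin m) ℂ, ∃! X : Matrix (Fin n) (Fin m) ℂ, A * X + Xᴴ * D = E) ↔
      (MatrixPencil.mk (-Dᴴ) A).IsRegular ∧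
      StarReciprocalFree (MatrixPencil.mk (-Dᴴ) A).spectrum) := by
  have hT : (∀ E : Matrix (Fin m) (Fin m) ℂ, ∃! X : Matrix (Fin n) (Fin m) ℂ,
      A * X + Xᵀ * D = E) ↔ Function.Bijective (starSylvester AlgEquiv.refl A D) :=
    (Function.bijective_iff_existsUnique _).symm
  have hC : (∀ E : Matrix (Fin m) (Fin m) ℂ, ∃! X : Matrix (Fin n) (Fin m) ℂ,
      A * X + Xᴴ * D = E) ↔ Function.Bijective (starSylvester Complex.conjAe A D) :=
    (Function.bijective_iff_existsUnique _).symm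
  rw [hT, hC]
  by_cases hmn : m = n
  · subst hmn
    have h1 := bijective_starSylvester_transpose_iff hm A Dᵀ
    have h2 := bijective_starSylvester_conjTranspose_iff hm A Dᴴ
    rw [twistTranspose_refl, transpose_transpose] at h1
    rw [twistTranspose_conjAe, conjTranspose_conjTranspose] at h2
    exact ⟨h1, h2⟩
  · exact ⟨⟨fun h => absurd (eq_of_bijective_starSylvester _ hm h) hmn, fun h => absurd h.1.1 hmn⟩,
      ⟨fun h => absurd (eq_of_bijective_starSylvester _ hm h) hmn, fun h => absurd h.1.1 hmn⟩⟩
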